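/- For a simple graph $G$ on a finite vertex set $V$, let $S(G)$ be the set of real symmetric matrices $A=(a_{ij})_{i,j\in V}$ such that, for $i\ne j$, $a_{ij}\neq 0$ if and only if $ij$ is an edge of $G$ (the diagonal is arbitrary), and let $q(G)$ be the minimum, over all $A\in S(G)$, of the number of distinct eigenvalues of $A$. The threshold graph with creation sequence $(b_1,\dots,b_n)\in\{0,1\}^n$ is the graph on $v_1,\dots,v_n$ obtained by adding the vertices in this order, where $v_i$ is added as an isolated vertex if $b_i=0$ and as a vertex adjacent to all previous vertices if $b_i=1$. Theorem. Let $n\ge 4$ be even and let $G$ be a graph isomorphic to the threshold graph of order $n$ with the alternating creation sequence $(0,1,0,1,\ldots,0,1)$. Then $q(G)=3$. Moreover, every simple graph $H$ on the same vertex set whose edge set contains that of $G$ satisfies $q(H)\le 3$. -/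

import Mathlib

/-- The set `S(G)` of symmetric matrices described by a graph `G`: the real symmetric matrices
whose off-diagonal entry at `(i, j)` is nonzero exactly when `ij` is an edge of `G`
(the diagonal entries are arbitrary). -/
def symmetricMatricesOf {V : Type*} (G : SimpleGraph V) : Set (Matrix V V ℝ) :=
  {A | A.IsSymm ∧ ∀ i j : V, i ≠ j → (A i j ≠ 0 ↔ G.Adj i j)}

/-- `q(A)`: the number of distinct eigenvalues of a real square matrix `A`. For a matrix over a
finite index type the spectrum is finite, and it is the set of eigenvalues. -/
noncomputable def numDistinctEigenvalues {V : Type*} [Fintype V] [DecidableEq V]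
    (A : Matrix V V ℝ) : ℕ :=
  (spectrum ℝ A).ncard

/-- `q(G)`: the minimum of `q(A)` over all `A ∈ S(G)`. It is attained, since `S(G)` is nonempty,
see `minDistinctEigenvalues_isLeast`. -/
noncomputable def minDistinctEigenvalues {V : Type*} [Fintype V] [DecidableEq V]
    (G : SimpleGraph V) : ℕ :=
  sInf (numDistinctEigenvalues '' symmetricMatricesOf G)

open Classical in
/-- The adjacency matrix belongs to `S(G)`. -/
theorem symmetricMatricesOf_nonempty {V : Type*} (G : SimpleGraph V) :
    (symmetricMatricesOf G).Nonempty := by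
  refine ⟨G.adjMatrix ℝ, G.isSymm_adjMatrix, fun i j _ => ?_⟩
  simp [SimpleGraph.adjMatrix_apply]

/-- The infimum in the definition of `q(G)` is a minimum. -/
theorem minDistinctEigenvalues_isLeast {V : Type*} [Fintype V] [DecidableEq V]
    (G : SimpleGraph V) :
    IsLeast (numDistinctEigenvalues '' symmetricMatricesOf G) (minDistinctEigenvalues G) :=
  ⟨Nat.sInf_mem ((symmetricMatricesOf_nonempty G).image _), fun _ h => Nat.sInf_le h⟩

/-- The threshold graph with creation sequence `b`. The vertices are added in the order
`0, 1, …, n - 1`; the vertex `i` is adjacent to all earlier vertices when it is added if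
`b i = true` (a dominating vertex, the character `1`), and to none of them if `b i = false`
(an isolated vertex, the character `0`). So two distinct vertices are adjacent exactly when the
later one is dominating. -/
def thresholdGraph {n : ℕ} (b : Fin n → Bool) : SimpleGraph (Fin n) where
  Adj i j := i ≠ j ∧ b (max i j) = true
  symm := ⟨fun i j h => ⟨h.1.symm, by rw [max_comm]; exact h.2⟩⟩
  loopless := ⟨fun _ h => h.1 rfl⟩

/-- The alternating creation sequence `(0, 1, 0, 1, …, 0, 1)` of length `2 t`. -/
def alternatingSequence (t : ℕ) : Fin (2 * t) → Bool :=
  fun i => decide (i.val % 2 = 1)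

open Matrix Filter Topology

/-! ### Annihilating polynomials and the lower bound. -/

section Spectrum

/-! Lower bound: if `A * A = a • A + b • 1`, nonadjacent vertices cannot have exactly one common
neighbour, but the first and last `0` of `G` do.

Upper bound: split `H` into the `0`s and the `1`s of `G`, and take `A = fromBlocks M C Cᵀ (Cᵀ * M⁻¹
* C)`, of rank `t`. If `C * Cᵀ = 2M - M² + xxᵀ`, its nonzero eigenvalues are those of `2 + M⁻¹xxᵀ`,
hence at most two values. Let `M = 1 + εF`, with `F` the adjacency matrix of `H` on the `0`s, and
`x` all ones; the condition becomes `C * Cᵀ = 1 - ε²F² + J`. At `ε = 0` it is solved by the Cholesky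
factor of `1 + J`, positive on and below the diagonal: these are the edges that `G` forces. The term
`J` provides this positivity. An open mapping argument (`map_gramLower_nhds`) gives solutions for
small `ε ≠ 0` with entries above the diagonal prescribed, so extra edges of `H` can be realised at
will. -/

theorem reindex_mem_symmetricMatricesOf {V W : Type*} (e : W ≃ V) {H : SimpleGraph V}
    {A : Matrix W W ℝ} (hA : A ∈ symmetricMatricesOf (H.comap e)) :
    Matrix.reindex e e A ∈ symmetricMatricesOf H := by
  refine ⟨?_, fun i j hij => ?_⟩
  · have := hA.1
    simpa using this.submatrix e.symm
  · simpa using hA.2 (e.symm i) (e.symm j) (by simpa using hij)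

variable {V W : Type*} [Fintype V] [DecidableEq V] [Fintype W] [DecidableEq W]

theorem numDistinctEigenvalues_reindex (e : W ≃ V) (A : Matrix W W ℝ) :
    numDistinctEigenvalues (Matrix.reindex e e A) = numDistinctEigenvalues A := by
  unfold numDistinctEigenvalues
  rw [← Matrix.coe_reindexAlgEquiv ℝ ℝ e, AlgEquiv.spectrum_eq]

theorem minDistinctEigenvalues_le_of_equiv (e : W ≃ V) {H : SimpleGraph V} {A : Matrix W W ℝ}
    (hA : A ∈ symmetricMatricesOf (H.comap e)) :
    minDistinctEigenvalues H ≤ numDistinctEigenvalues A := by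
  rw [← numDistinctEigenvalues_reindex e A]
  exact (minDistinctEigenvalues_isLeast H).2 ⟨_, reindex_mem_symmetricMatricesOf e hA, rfl⟩

theorem numDistinctEigenvalues_le_natDegree {A : Matrix V V ℝ} {p : Polynomial ℝ} (hp : p ≠ 0)
    (h : Polynomial.aeval A p = 0) : numDistinctEigenvalues A ≤ p.natDegree := by
  have hsub : spectrum ℝ A ⊆ (p.roots.toFinset : Set ℝ) := by
    intro r hr
    have h1 := spectrum.subset_polynomial_aeval A p ⟨r, hr, rfl⟩
    rw [h] at h1
    have : Polynomial.eval r p = 0 := by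
      by_contra hne
      rw [spectrum.mem_iff, sub_zero] at h1
      exact h1 ((IsUnit.mk0 _ hne).map (algebraMap ℝ (Matrix V V ℝ)))
    simp [hp, this]
  refine (Set.ncard_le_ncard hsub (Finset.finite_toSet _)).trans ?_
  rw [Set.ncard_coe_finset]
  exact (Multiset.toFinset_card_le _).trans p.card_roots'

/-- A symmetric matrix with at most two eigenvalues satisfies a monic quadratic equation. -/
theorem exists_sq_eq_of_numDistinctEigenvalues_le_two {A : Matrix V V ℝ} (hA : A.IsSymm)
    (h : numDistinctEigenvalues A ≤ 2) : ∃ a b : ℝ, A * A = a • A + b • 1 := by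
  have hfin : (spectrum ℝ A).Finite := A.finite_real_spectrum
  obtain ⟨a, b, hab⟩ : ∃ a b : ℝ, spectrum ℝ A ⊆ {a, b} := by
    unfold numDistinctEigenvalues at h
    interval_cases hc : (spectrum ℝ A).ncard
    · rw [Set.ncard_eq_zero hfin] at hc
      exact ⟨0, 0, by simp [hc]⟩
    · obtain ⟨a, ha⟩ := Set.ncard_eq_one.1 hc
      exact ⟨a, a, by simp [ha]⟩
    · obtain ⟨a, b, -, h2⟩ := Set.ncard_eq_two.1 hc
      exact ⟨a, b, h2.le⟩
  have hsa : IsSelfAdjoint A := by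
    rw [← Matrix.isHermitian_iff_isSelfAdjoint]
    rw [Matrix.IsHermitian, Matrix.conjTranspose_eq_transpose_of_trivial, hA]
  set p : Polynomial ℝ := (Polynomial.X - Polynomial.C a) * (Polynomial.X - Polynomial.C b)
  -- Symmetry enters here: by the functional calculus, `p(A)` is zero once `p` vanishes on the
  -- spectrum.
  have h0 : Polynomial.aeval A p = 0 := by
    rw [← cfc_polynomial p A hsa, ← cfc_zero ℝ A]
    refine cfc_congr fun r hr => ?_
    rcases hab hr with h | h <;> simp_all [p]
  refine ⟨a + b, -(a * b), ?_⟩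
  simp only [p, map_mul, map_sub, Polynomial.aeval_X, Polynomial.aeval_C,
    Algebra.algebraMap_eq_smul_one, sub_mul, mul_sub, smul_mul_assoc, mul_smul_comm, one_mul,
    mul_one, smul_smul, add_smul, neg_smul] at h0 ⊢
  rw [← sub_eq_zero, ← h0]
  match_scalars <;> ring

/-- If two nonadjacent vertices have exactly one common neighbour, a graph needs at least three
distinct eigenvalues. -/
theorem three_le_minDistinctEigenvalues {G : SimpleGraph V} {u v w : V} (huv : u ≠ v)
    (hnadj : ¬ G.Adj u v) (huw : G.Adj u w) (hwv : G.Adj w v)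
    (huniq : ∀ z, G.Adj u z → G.Adj z v → z = w) : 3 ≤ minDistinctEigenvalues G := by
  obtain ⟨A, hA, hAq⟩ := (minDistinctEigenvalues_isLeast G).1
  rw [← hAq]
  by_contra hlt
  obtain ⟨a, b, hab⟩ := exists_sq_eq_of_numDistinctEigenvalues_le_two hA.1 (by omega)
  have h0 : A u v = 0 := by
    by_contra h
    exact hnadj ((hA.2 u v huv).1 h)
  have h1 := congrFun (congrFun hab u) v
  rw [Matrix.mul_apply, Finset.sum_eq_single w] at h1
  · simp [h0, huv] at h1
    rcases h1 with h1 | h1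
    · exact (hA.2 u w huw.ne).2 huw h1
    · exact (hA.2 w v hwv.ne).2 hwv h1
  · intro z _ hz
    by_contra hne
    have hz1 : A u z ≠ 0 := left_ne_zero_of_mul hne
    have hz2 : A z v ≠ 0 := right_ne_zero_of_mul hne
    by_cases huz : u = z
    · subst huz; exact hz2 h0
    by_cases hzv : z = v
    · subst hzv; exact hz1 h0
    exact hz (huniq z ((hA.2 u z huz).1 hz1) ((hA.2 z v hzv).1 hz2))
  · simp

end Spectrum

/-! ### The bordered matrix with three eigenvalues. -/

section Blocks

variable {ι : Type*} [Fintype ι] [DecidableEq ι]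

/-- The bordered matrix whose Schur complement vanishes has at most three distinct eigenvalues
if `C * Cᵀ = 2 • M - M * M + x xᵀ`. -/
theorem numDistinctEigenvalues_fromBlocks_le {M C : Matrix ι ι ℝ} (x : ι → ℝ) 
    (hdet : IsUnit M.det) (hC : C * Cᵀ = (2 : ℝ) • M - M * M + vecMulVec x x) :
    numDistinctEigenvalues (fromBlocks M C Cᵀ (Cᵀ * M⁻¹ * C)) ≤ 3 := by
  set A := fromBlocks M C Cᵀ (Cᵀ * M⁻¹ * C) with hA
  set X : Matrix ι ι ℝ := vecMulVec x x with hX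
  have h1 : M * M⁻¹ = 1 := Matrix.mul_nonsing_inv _ hdet
  have h2 : M⁻¹ * M = 1 := Matrix.nonsing_inv_mul _ hdet
  have hC' : ∀ Z : Matrix ι ι ℝ, C * (Cᵀ * Z) = (2 : ℝ) • (M * Z) - M * (M * Z) + X * Z := by
    intro Z
    rw [← mul_assoc, hC]
    simp only [add_mul, sub_mul, smul_mul_assoc, mul_assoc]
  have h1' : ∀ Z, M * (M⁻¹ * Z) = Z := fun Z => by rw [← mul_assoc, h1, one_mul]
  have h2' : ∀ Z, M⁻¹ * (M * Z) = Z := fun Z => by rw [← mul_assoc, h2, one_mul]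
  set s : ℝ := x ⬝ᵥ M⁻¹ *ᵥ x
  have hs : ∀ Z, X * (M⁻¹ * (X * Z)) = s • (X * Z) := by
    intro Z
    rw [← mul_assoc, ← mul_assoc, ← smul_mul_assoc]
    congr 1
    rw [mul_assoc, hX, Matrix.mul_vecMulVec, Matrix.vecMulVec_mul_vecMulVec, Matrix.vecMulVec_smul]
  have hs' : X * (M⁻¹ * X) = s • X := by simpa using hs 1
  -- `B` is the column `(x, CᵀM⁻¹x)` times the row `(xᵀ, xᵀM⁻¹C)`; the column is fixed by `A` up to
  -- the factor `2 + s`.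
  set B := fromBlocks X (X * M⁻¹ * C) (Cᵀ * M⁻¹ * X) (Cᵀ * M⁻¹ * X * M⁻¹ * C)
  have hsq : A * A = (2 : ℝ) • A + B := by
    simp only [hA, B, fromBlocks_multiply, fromBlocks_smul, fromBlocks_add, mul_assoc, hC', h1',
      h2', hC, h2, mul_one, mul_add, mul_sub, mul_smul_comm]
    congr 1 <;> abel
  have hAB : A * B = (2 + s) • B := by
    simp only [hA, B, fromBlocks_multiply, fromBlocks_smul, fromBlocks_add, mul_assoc, hC', h1',
      h2', mul_add, mul_sub, mul_smul_comm, hs, hs', add_smul]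
    congr 1 <;> abel
  set p : Polynomial ℝ := Polynomial.X * (Polynomial.X - Polynomial.C 2) *
    (Polynomial.X - Polynomial.C (2 + s)) with hp
  have hmon : p.Monic := (Polynomial.monic_X.mul (Polynomial.monic_X_sub_C _)).mul
    (Polynomial.monic_X_sub_C _)
  have hdeg : p.natDegree = 3 := by
    rw [hp]; compute_degree!
  rw [← hdeg]
  refine numDistinctEigenvalues_le_natDegree hmon.ne_zero ?_
  have hB : B = A * A - (2 : ℝ) • A := by rw [hsq]; abel
  rw [hB] at hAB
  simp only [hp, map_mul, map_sub, Polynomial.aeval_X, Polynomial.aeval_C,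
    Algebra.algebraMap_eq_smul_one]
  simp only [sub_mul, mul_sub, smul_mul_assoc, mul_smul_comm, mul_one,
    mul_assoc, smul_sub] at hAB ⊢
  rw [hAB]
  abel

end Blocks

/-! ### Openness of the Gram map at a triangular matrix. -/

section Triangular

variable {ι : Type*} [Fintype ι] [LinearOrder ι]

/-- On and below the diagonal this is `C * Cᵀ`, above the diagonal it is `C`. -/
def gramLower (C : ι → ι → ℝ) : ι → ι → ℝ :=
  fun i j => if j ≤ i then ∑ k, C i k * C j k else C i j

/-- The derivative of `gramLower` at `C`. -/
noncomputable def gramLowerDeriv (C : ι → ι → ℝ) : (ι → ι → ℝ) →L[ℝ] (ι → ι → ℝ) :=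
  ContinuousLinearMap.pi fun i => ContinuousLinearMap.pi fun j =>
    if j ≤ i then
      ∑ k, (C i k • (ContinuousLinearMap.proj (R := ℝ) (φ := fun _ : ι => ℝ) k ∘L
          ContinuousLinearMap.proj (R := ℝ) (φ := fun _ : ι => ι → ℝ) j) +
        C j k • (ContinuousLinearMap.proj (R := ℝ) (φ := fun _ : ι => ℝ) k ∘L
          ContinuousLinearMap.proj (R := ℝ) (φ := fun _ : ι => ι → ℝ) i))
    else ContinuousLinearMap.proj (R := ℝ) (φ := fun _ : ι => ℝ) j ∘L
      ContinuousLinearMap.proj (R := ℝ) (φ := fun _ : ι => ι → ℝ) i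

theorem gramLowerDeriv_apply (C X : ι → ι → ℝ) (i j : ι) :
    gramLowerDeriv C X i j =
      if j ≤ i then ∑ k, (C i k * X j k + C j k * X i k) else X i j := by
  by_cases h : j ≤ i <;> simp [gramLowerDeriv, h]

theorem hasStrictFDerivAt_gramLower (C : ι → ι → ℝ) :
    HasStrictFDerivAt gramLower (gramLowerDeriv C) C := by
  have hproj : ∀ i j : ι, HasStrictFDerivAt (fun C : ι → ι → ℝ => C i j)
      (ContinuousLinearMap.proj (R := ℝ) (φ := fun _ : ι => ℝ) j ∘L
        ContinuousLinearMap.proj (R := ℝ) (φ := fun _ : ι => ι → ℝ) i) C :=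
    fun i j => (ContinuousLinearMap.proj (R := ℝ) (φ := fun _ : ι => ℝ) j ∘L
      ContinuousLinearMap.proj (R := ℝ) (φ := fun _ : ι => ι → ℝ) i).hasStrictFDerivAt
  refine hasStrictFDerivAt_pi.2 fun i => hasStrictFDerivAt_pi.2 fun j => ?_
  by_cases h : j ≤ i
  · simp only [gramLower, h, if_true]
    exact HasStrictFDerivAt.fun_sum fun k _ => (hproj i k).mul (hproj j k)
  · simp only [gramLower, h, if_false]
    exact hproj i j

/-- It suffices to prove injectivity. A kernel element `X` is lower triangular with `C * Xᵀ + X * Cᵀ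
= 0`, so `C⁻¹ * X` is both lower triangular and skew-symmetric, hence zero. -/
theorem gramLowerDeriv_surjective {C : Matrix ι ι ℝ} (hC : ∀ i j, i < j → C i j = 0)
    (hdiag : ∀ i, C i i ≠ 0) : (gramLowerDeriv C).range = ⊤ := by
  have hlow : C.BlockTriangular OrderDual.toDual := fun i j h => hC i j h
  have hdet : IsUnit C.det := by
    rw [Matrix.det_of_isLowerTriangular C hlow, isUnit_iff_ne_zero]
    exact Finset.prod_ne_zero_iff.2 fun i _ => hdiag i
  rw [LinearMap.range_eq_top]
  refine LinearMap.injective_iff_surjective.1 ((injective_iff_map_eq_zero _).2 ?_)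
  intro x hx
  set X : Matrix ι ι ℝ := Matrix.of x with hXx
  have hX' : ∀ i j, (if j ≤ i then ∑ k, (C i k * X j k + C j k * X i k) else X i j) = 0 := by
    intro i j
    exact (gramLowerDeriv_apply C x i j).symm.trans (congrFun (congrFun hx i) j)
  have hXlow : X.BlockTriangular OrderDual.toDual := by
    intro i j h
    have h' : i < j := h
    simpa [not_le.2 h'] using hX' i j
  have hle : ∀ i j, j ≤ i → (C * Xᵀ + X * Cᵀ) i j = 0 := by
    intro i j h
    have := hX' i j
    rw [if_pos h] at this
    rw [← this]
    simp [Matrix.mul_apply, Finset.sum_add_distrib, mul_comm]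
  have hsym : C * Xᵀ + X * Cᵀ = 0 := by
    ext i j
    rcases le_total j i with h | h
    · exact hle i j h
    · have := hle j i h
      rw [← Matrix.transpose_apply (C * Xᵀ + X * Cᵀ), Matrix.transpose_add,
        Matrix.transpose_mul, Matrix.transpose_mul, Matrix.transpose_transpose,
        Matrix.transpose_transpose, add_comm] at this
      exact this
  have := Matrix.invertibleOfIsUnitDet C hdet
  have h1 : C⁻¹ * C = 1 := Matrix.nonsing_inv_mul _ hdet
  have h1t : Cᵀ * C⁻¹ᵀ = 1 := by rw [← Matrix.transpose_mul, h1, Matrix.transpose_one]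
  have hYlow : (C⁻¹ * X).BlockTriangular OrderDual.toDual :=
    (Matrix.blockTriangular_inv_of_blockTriangular hlow).mul hXlow
  have hskew : (C⁻¹ * X)ᵀ + C⁻¹ * X = 0 := by
    have h2 : C⁻¹ * (C * Xᵀ + X * Cᵀ) * C⁻¹ᵀ = (C⁻¹ * X)ᵀ + C⁻¹ * X := by
      rw [mul_add, add_mul, ← mul_assoc, h1, one_mul, ← mul_assoc, mul_assoc, h1t, mul_one,
        Matrix.transpose_mul]
    rw [← h2, hsym]
    simp
  have hY : C⁻¹ * X = 0 := by
    ext i j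
    have hij := congrFun (congrFun hskew i) j
    simp only [Matrix.add_apply, Matrix.transpose_apply, Matrix.zero_apply] at hij ⊢
    rcases lt_trichotomy i j with h | rfl | h
    · exact hYlow h
    · linarith
    · rw [hYlow (i := j) (j := i) h] at hij
      linarith
  have : C * (C⁻¹ * X) = X := by
    rw [← mul_assoc, Matrix.mul_nonsing_inv _ hdet, one_mul]
  rw [hY, mul_zero] at this
  exact this.symm

theorem map_gramLower_nhds {C : Matrix ι ι ℝ} (hC : ∀ i j, i < j → C i j = 0)
    (hdiag : ∀ i, C i i ≠ 0) :
    map (gramLower (ι := ι)) (𝓝 C) = 𝓝 (gramLower C) :=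
  (hasStrictFDerivAt_gramLower C).map_nhds_eq_of_surj (gramLowerDeriv_surjective hC hdiag)

end Triangular

/-! ### The explicit solution at `ε = 0`. -/

section Cholesky

/-- The lower triangular Cholesky factor of `1 + J`, where `J` is the all-ones matrix. -/
noncomputable def choleskyOneAddOnes (t : ℕ) : Matrix (Fin t) (Fin t) ℝ :=
  Matrix.of fun i j => if j < i then 1 / √((j + 1 : ℝ) * (j + 2)) else
    if j = i then (j + 2 : ℝ) / √((j + 1 : ℝ) * (j + 2)) else 0

variable {t : ℕ}

theorem choleskyOneAddOnes_of_lt {i j : Fin t} (h : i < j) : choleskyOneAddOnes t i j = 0 := by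
  simp [choleskyOneAddOnes, h.not_gt, h.ne']

theorem choleskyOneAddOnes_pos {i j : Fin t} (h : j ≤ i) : 0 < choleskyOneAddOnes t i j := by
  rcases h.lt_or_eq with h | rfl
  · simp only [choleskyOneAddOnes, Matrix.of_apply, h, if_true]; positivity
  · simp only [choleskyOneAddOnes, Matrix.of_apply, lt_irrefl, if_false, if_true]; positivity

theorem choleskyOneAddOnes_nonneg (i j : Fin t) : 0 ≤ choleskyOneAddOnes t i j := by
  rcases le_or_gt j i with h | h
  · exact (choleskyOneAddOnes_pos h).le
  · exact (choleskyOneAddOnes_of_lt h).ge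

theorem sum_range_one_div_mul_succ (n : ℕ) :
    ∑ k ∈ Finset.range n, 1 / ((k + 1 : ℝ) * (k + 2)) = 1 - 1 / (n + 1 : ℝ) := by
  induction n with
  | zero => simp
  | succ n ih =>
    rw [Finset.sum_range_succ, ih]
    push_cast
    field_simp
    ring

theorem sum_Iio_one_div_mul_succ (i : Fin t) :
    ∑ k ∈ Finset.Iio i, 1 / ((k + 1 : ℝ) * (k + 2)) = 1 - 1 / (i + 1 : ℝ) := by
  rw [← sum_range_one_div_mul_succ, ← Nat.Iio_eq_range, ← Fin.map_valEmbedding_Iio,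
    Finset.sum_map]
  rfl

/-- The columns before `j` contribute a telescoping sum `1 - 1/(j+1)`; column `j` supplies the rest.
-/
theorem choleskyOneAddOnes_sum_of_le {i j : Fin t} (h : j ≤ i) :
    ∑ k, choleskyOneAddOnes t i k * choleskyOneAddOnes t j k = (if i = j then 1 else 0) + 1 := by
  have hsq : ∀ k : Fin t, √((k + 1 : ℝ) * (k + 2)) * √((k + 1 : ℝ) * (k + 2)) =
      (k + 1 : ℝ) * (k + 2) := fun k => Real.mul_self_sqrt (by positivity)
  have hsub : ∑ k, choleskyOneAddOnes t i k * choleskyOneAddOnes t j k =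
      ∑ k ∈ Finset.Iic j, choleskyOneAddOnes t i k * choleskyOneAddOnes t j k := by
    symm
    refine Finset.sum_subset (Finset.subset_univ _) fun k _ hk => ?_
    rw [choleskyOneAddOnes_of_lt (i := j) (j := k) (by simpa using hk), mul_zero]
  have hlt : ∑ k ∈ Finset.Iio j, choleskyOneAddOnes t i k * choleskyOneAddOnes t j k =
      1 - 1 / (j + 1 : ℝ) := by
    rw [← sum_Iio_one_div_mul_succ]
    refine Finset.sum_congr rfl fun k hk => ?_
    have hk : k < j := by simpa using hk
    simp only [choleskyOneAddOnes, Matrix.of_apply, hk, hk.trans_le h, if_true]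
    rw [div_mul_div_comm, hsq, one_mul]
  have hj : (0 : ℝ) < j + 1 := by positivity
  rw [hsub, ← Finset.Iio_insert, Finset.sum_insert (by simp), hlt]
  rcases h.lt_or_eq with h | rfl
  · simp only [choleskyOneAddOnes, Matrix.of_apply, h, h.ne', lt_irrefl, if_true, if_false]
    rw [div_mul_div_comm, hsq]
    field_simp
    ring
  · simp only [choleskyOneAddOnes, Matrix.of_apply, lt_irrefl, if_true, if_false]
    rw [div_mul_div_comm, hsq]
    field_simp
    ring

end Cholesky

/-! ### Perturbation to an arbitrary supergraph. -/

section Completion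

variable {t : ℕ}

theorem eventually_exists_gram_eq (L : Fin t → Fin t → ℝ) {Q : Matrix (Fin t) (Fin t) ℝ}
    (hQ : Q.IsSymm) {p : ℝ × Matrix (Fin t) (Fin t) ℝ → Prop}
    (hp : ∀ᶠ z in 𝓝 ((0 : ℝ), choleskyOneAddOnes t), p z) :
    ∃ ε : ℝ, ε ≠ 0 ∧ ∃ C : Matrix (Fin t) (Fin t) ℝ, p (ε, C) ∧
      (∀ i j, i < j → C i j = ε * L i j) ∧
      C * Cᵀ = 1 - (ε * ε) • Q + vecMulVec 1 1 := by
  set T : ℝ → Fin t → Fin t → ℝ := fun ε i j =>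
    if j ≤ i then (if i = j then 1 else 0) - ε * ε * Q i j + 1 else ε * L i j with hT
  have hT0 : T 0 = gramLower (choleskyOneAddOnes t) := by
    funext i j
    by_cases h : j ≤ i
    · simp [hT, gramLower, h, choleskyOneAddOnes_sum_of_le h]
    · simp [hT, gramLower, h, choleskyOneAddOnes_of_lt (not_le.1 h)]
  have hTc : Continuous T := by
    refine continuous_pi fun i => continuous_pi fun j => ?_
    by_cases h : j ≤ i <;> simp only [hT, h, if_true, if_false] <;> fun_prop
  rw [nhds_prod_eq, eventually_prod_iff] at hp
  obtain ⟨pε, hpε, pC, hpC, hp⟩ := hp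
  have himage : gramLower '' {C : Fin t → Fin t → ℝ | pC C} ∈ 𝓝 (T 0) := by
    rw [hT0, ← map_gramLower_nhds (fun _ _ => choleskyOneAddOnes_of_lt)
      fun i => (choleskyOneAddOnes_pos le_rfl).ne']
    exact image_mem_map hpC
  -- The punctured neighbourhood secures `ε ≠ 0`.
  have hev : ∀ᶠ ε in 𝓝[≠] (0 : ℝ), ε ≠ 0 ∧ pε ε ∧
      T ε ∈ gramLower '' {C : Fin t → Fin t → ℝ | pC C} :=
    eventually_mem_nhdsWithin.and
      ((hpε.and (hTc.continuousAt.eventually_mem himage)).filter_mono nhdsWithin_le_nhds)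
  obtain ⟨ε, hε, hε1, C, hC, hCT⟩ := hev.exists
  have hCT' : ∀ i j, gramLower C i j = T ε i j := fun i j => by rw [hCT]
  refine ⟨ε, hε, Matrix.of C, hp hε1 hC, fun i j h => ?_, ?_⟩
  · simpa [gramLower, hT, not_le.2 h] using hCT' i j
  · have hle : ∀ i j, j ≤ i → (Matrix.of C * (Matrix.of C)ᵀ) i j =
        (1 - (ε * ε) • Q + vecMulVec 1 1 : Matrix (Fin t) (Fin t) ℝ) i j := by
      intro i j h
      have := hCT' i j
      simp only [gramLower, hT, h, if_true] at this
      simpa [Matrix.mul_apply, Matrix.one_apply, vecMulVec_apply] using this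
    ext i j
    rcases le_total j i with h | h
    · exact hle i j h
    · have h1 : (Matrix.of C * (Matrix.of C)ᵀ).IsSymm := Matrix.isSymm_mul_transpose_self _
      have h2 : (1 - (ε * ε) • Q + vecMulVec 1 1 : Matrix (Fin t) (Fin t) ℝ).IsSymm :=
        (Matrix.isSymm_one.sub (hQ.smul _)).add (Matrix.transpose_vecMulVec 1 1)
      rw [← h1.apply, ← h2.apply]
      exact hle j i h

open Classical in
/-- A graph on `Fin t ⊕ Fin t` in which the right part is a clique and the left vertex `i` is
adjacent to the right vertices `j ≤ i` has a matrix with at most three distinct eigenvalues. -/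
theorem exists_numDistinctEigenvalues_le_three (H : SimpleGraph (Fin t ⊕ Fin t))
    (hclique : ∀ i j : Fin t, i ≠ j → H.Adj (.inr i) (.inr j))
    (hhalf : ∀ i j : Fin t, j ≤ i → H.Adj (.inl i) (.inr j)) :
    ∃ A ∈ symmetricMatricesOf H, numDistinctEigenvalues A ≤ 3 := by
  set F : Matrix (Fin t) (Fin t) ℝ := (H.comap Sum.inl).adjMatrix ℝ with hF
  have hFs : F.IsSymm := SimpleGraph.isSymm_adjMatrix _
  have hcM : Continuous fun z : ℝ × Matrix (Fin t) (Fin t) ℝ => 1 + z.1 • F := by fun_prop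
  have hcdet : Continuous fun z : ℝ × Matrix (Fin t) (Fin t) ℝ => (1 + z.1 • F).det :=
    hcM.matrix_det
  -- The adjugate replaces the inverse: it is continuous everywhere and differs from it by a nonzero
  -- scalar when `det ≠ 0`.
  have hcD : Continuous fun z : ℝ × Matrix (Fin t) (Fin t) ℝ =>
      z.2ᵀ * (1 + z.1 • F).adjugate * z.2 :=
    ((continuous_snd.matrix_transpose).matrix_mul hcM.matrix_adjugate).matrix_mul continuous_snd
  obtain ⟨ε, hε, C, ⟨hdet, hClow, hD⟩, hCup, hCC⟩ := eventually_exists_gram_eq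
    (fun i j => if H.Adj (.inl i) (.inr j) then 1 else 0) (hFs.pow 2)
    (p := fun z => (1 + z.1 • F).det ≠ 0 ∧ (∀ i j : Fin t, j ≤ i → z.2 i j ≠ 0) ∧
      ∀ i j : Fin t, i ≠ j → (z.2ᵀ * (1 + z.1 • F).adjugate * z.2) i j ≠ 0) (by
    refine ((hcdet.continuousAt).eventually_ne (by simp)).and (.and ?_ ?_)
    · refine eventually_all.2 fun i => eventually_all.2 fun j => eventually_imp_distrib_left.2
        fun h => ?_
      exact (continuous_snd.matrix_elem i j).continuousAt.eventually_ne
        (choleskyOneAddOnes_pos h).ne'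
    · refine eventually_all.2 fun i => eventually_all.2 fun j => eventually_imp_distrib_left.2
        fun h => ?_
      refine (hcD.matrix_elem i j).continuousAt.eventually_ne (ne_of_gt ?_)
      simp only [zero_smul, add_zero, Matrix.adjugate_one, mul_one, Matrix.mul_apply,
        Matrix.transpose_apply]
      -- Row `max i j` is positive in both columns.
      refine Finset.sum_pos' (fun k _ => mul_nonneg (choleskyOneAddOnes_nonneg _ _)
        (choleskyOneAddOnes_nonneg _ _)) ⟨max i j, Finset.mem_univ _, ?_⟩
      exact mul_pos (choleskyOneAddOnes_pos (le_max_left _ _))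
        (choleskyOneAddOnes_pos (le_max_right _ _)))
  set M := 1 + ε • F with hM
  have hMs : M.IsSymm := Matrix.isSymm_one.add (hFs.smul ε)
  have hCadj : ∀ i j, C i j ≠ 0 ↔ H.Adj (.inl i) (.inr j) := by
    intro i j
    rcases le_or_gt j i with h | h
    · exact iff_of_true (hClow i j h) (hhalf i j h)
    · rw [hCup i j h]
      simp [hε]
  refine ⟨fromBlocks M C Cᵀ (Cᵀ * M⁻¹ * C), ⟨?_, ?_⟩, ?_⟩
  · refine Matrix.IsSymm.fromBlocks hMs rfl ?_
    rw [Matrix.IsSymm, Matrix.transpose_mul, Matrix.transpose_mul, Matrix.transpose_transpose,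
      Matrix.transpose_nonsing_inv, hMs, mul_assoc]
  · rintro (i | i) (j | j) hij
    · have hij' : i ≠ j := fun h => hij (h ▸ rfl)
      simp [hM, hF, hij', hε]
    · simpa using hCadj i j
    · simpa [H.adj_comm] using hCadj j i
    · have hij' : i ≠ j := fun h => hij (h ▸ rfl)
      refine iff_of_true ?_ (hclique i j hij')
      have := hD i j hij'
      rw [Matrix.fromBlocks_apply₂₂, Matrix.inv_def, Matrix.mul_smul, Matrix.smul_mul,
        Matrix.smul_apply, smul_eq_mul]
      exact mul_ne_zero (by simpa using hdet) this
  · refine numDistinctEigenvalues_fromBlocks_le 1 (isUnit_iff_ne_zero.2 hdet) ?_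
    -- `2M - M² = 1 - (M - 1)² = 1 - ε²F²`.
    rw [hCC, hM]
    congr 1
    simp only [mul_add, add_mul, mul_one, one_mul, smul_mul_assoc, mul_smul_comm, pow_two]
    match_scalars <;> ring

end Completion

/-- Splits the positions of the alternating sequence into `0`s (left) and `1`s (right),
both in decreasing order. -/
def alternatingEquiv (t : ℕ) : Fin t ⊕ Fin t ≃ Fin (2 * t) where
  toFun := Sum.elim (fun i => ⟨2 * (t - 1 - i), by omega⟩) fun i => ⟨2 * (t - 1 - i) + 1, by omega⟩
  invFun k := if k.val % 2 = 0 then .inl ⟨t - 1 - k / 2, by omega⟩ else .inr ⟨t - 1 - k / 2, by omega⟩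
  left_inv := by
    rintro (i | i)
    · simp [Fin.ext_iff]; omega
    · have : (2 * (t - 1 - i.val) + 1) % 2 = 1 := by omega
      simp [this, Fin.ext_iff]; omega
  right_inv k := by
    rcases Nat.mod_two_eq_zero_or_one k with h | h <;> simp [h, Fin.ext_iff] <;> omega

theorem thresholdGraph_alternatingSequence_adj {t : ℕ} (i j : Fin (2 * t)) :
    (thresholdGraph (alternatingSequence t)).Adj i j ↔
      i ≠ j ∧ (max i.val j.val) % 2 = 1 := by
  simp [thresholdGraph, alternatingSequence]

theorem theorem5p1 {V : Type*} [Fintype V] [DecidableEq V] (t : ℕ) (ht : 2 ≤ t)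
    (G : SimpleGraph V)
    (hG : Nonempty (G ≃g thresholdGraph (alternatingSequence t))) :
    minDistinctEigenvalues G = 3 ∧
      ∀ H : SimpleGraph V, G ≤ H → minDistinctEigenvalues H ≤ 3 := by
  obtain ⟨f⟩ := hG
  have hadj : ∀ i j : Fin (2 * t), G.Adj (f.symm i) (f.symm j) ↔
      i ≠ j ∧ (max i.val j.val) % 2 = 1 := fun i j => by
    rw [f.symm.map_adj_iff, thresholdGraph_alternatingSequence_adj]
  have hupper : ∀ H : SimpleGraph V, G ≤ H → minDistinctEigenvalues H ≤ 3 := by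
    intro H hGH
    -- In decreasing order, the `0` with index `i` precedes the `1` with index `j` exactly when `j ≤
    -- i`.
    let e : Fin t ⊕ Fin t ≃ V := (alternatingEquiv t).trans f.symm.toEquiv
    obtain ⟨A, hA, hA3⟩ := exists_numDistinctEigenvalues_le_three (H.comap e)
      (fun i j hij => hGH ((hadj _ _).2 (by
        simp [alternatingEquiv, Fin.ext_iff] at hij ⊢; omega)))
      (fun i j hij => hGH ((hadj _ _).2 (by
        simp [alternatingEquiv, Fin.ext_iff] at hij ⊢; omega)))
    exact (minDistinctEigenvalues_le_of_equiv e hA).trans hA3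
  refine ⟨le_antisymm (hupper G le_rfl) ?_, hupper⟩
  -- The last `0` has only the final vertex as neighbour; `t ≥ 2` separates it from the first `0`.
  refine three_le_minDistinctEigenvalues (u := f.symm ⟨2 * t - 2, by omega⟩)
    (v := f.symm ⟨0, by omega⟩) (w := f.symm ⟨2 * t - 1, by omega⟩) ?_ ?_ ?_ ?_ ?_
  · simp [Fin.ext_iff]; omega
  · rw [hadj]; simp; omega
  · rw [hadj]; simp [Fin.ext_iff]; omega
  · rw [hadj]; simp [Fin.ext_iff]; omega
  · intro z
    obtain ⟨k, rfl⟩ := f.symm.surjective z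
    rw [hadj, hadj]
    simp only [ne_eq, Fin.ext_iff, EmbeddingLike.apply_eq_iff_eq]
    omega
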